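/- Let $M$ be a von Neumann algebra with a faithful normal finite trace $\tau$, and let $L^1(M,\tau)$ be the completion of $M$ in the norm $\|x\|_1=\tau(|x|)$, with $\tau$ extended continuously to $L^1(M,\tau)$. A bounded linear operator $T:L^1(M,\tau)\to L^1(M,\tau)$ is called stochastic if $Tx\ge 0$ and $\tau(Tx)=\tau(x)$ for every $x\ge 0$ in $L^1(M,\tau)$. Put $$\bar\rho(T)=\sup\Big\{\lim_{n\to\infty}\frac{\|T^n(u-v)\|_1}{\|u-v\|_1}\;:\; u,v\in L^1(M,\tau),\ u,v\ge 0,\ \|u\|_1=\|v\|_1,\ u\ne v\Big\},$$ with $\bar\rho(T)=0$ if there are no such pairs $u,v$. The operator $T$ is called completely mixing if $\bar\rho(T)=0$. **Theorem 4.2.** Let $T$ be a stochastic operator on $L^1(M,\tau)$. Then the limits above exist, their supremum is finite, and $\bar\rho(T)=0$ or $\bar\rho(T)=1$. Hence, if $\bar\rho(T)<1$, then $T$ is completely mixing. -/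

import Mathlib

open Filter Topology UniformSpace
open scoped ComplexOrder

/-- A faithful normal finite trace on a von Neumann algebra `M`: a positive linear functional `τ`
with `τ(ab) = τ(ba)`, vanishing on no nonzero positive element, and preserving suprema of
increasing (that is, upward directed) families of positive elements. -/
structure FaithfulNormalFiniteTrace (M : Type*) [CStarAlgebra M] [PartialOrder M]
    [StarOrderedRing M] extends M →ₚ[ℂ] ℂ where
  trace_mul_comm : ∀ a b : M, toFun (a * b) = toFun (b * a)
  faithful : ∀ a : M, 0 ≤ a → toFun a = 0 → a = 0
  normal : ∀ (D : Set M) (s : M), D.Nonempty → (∀ a ∈ D, 0 ≤ a) → DirectedOn (· ≤ ·) D →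
    IsLUB D s → IsLUB (toFun '' D) (toFun s)

namespace FaithfulNormalFiniteTrace

variable {M : Type*} [CStarAlgebra M] [PartialOrder M] [StarOrderedRing M]

noncomputable instance : CoeFun (FaithfulNormalFiniteTrace M) (fun _ => M → ℂ) where
  coe τ := τ.toPositiveLinearMap

/-- The number `τ(|x|)`, where `|x| = (x* x)^{1/2}` (as `|x|` is positive, `τ(|x|)` is real). -/
noncomputable def traceAbs (τ : FaithfulNormalFiniteTrace M) (x : M) : ℝ := (τ (CFC.abs x)).re

theorem mul_comm' (τ : FaithfulNormalFiniteTrace M) (a b : M) : τ (a * b) = τ (b * a) :=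
  τ.trace_mul_comm a b

theorem re_nonneg (τ : FaithfulNormalFiniteTrace M) {a : M} (ha : 0 ≤ a) : 0 ≤ (τ a).re :=
  (Complex.nonneg_iff.mp (τ.toPositiveLinearMap.map_nonneg ha)).1

theorem norm_mul_le_of_nonneg (τ : FaithfulNormalFiniteTrace M) (a : M) {h : M} (hh : 0 ≤ h) :
    ‖τ (a * h)‖ ≤ ‖a‖ * (τ h).re := by
  set f := τ.toPositiveLinearMap with hf
  set s := CFC.sqrt h with hs
  have hs0 : 0 ≤ s := CFC.sqrt_nonneg h
  have hss : s * s = h := CFC.sqrt_mul_sqrt_self h hh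
  have hst : star s = s := (IsSelfAdjoint.of_nonneg hs0).star_eq
  have h1 : τ (a * h) = inner ℂ (f.toPreGNS s) (f.toPreGNS (a * s)) := by
    rw [PositiveLinearMap.preGNS_inner_def, PositiveLinearMap.ofPreGNS_toPreGNS,
      PositiveLinearMap.ofPreGNS_toPreGNS, hst, ← hss, ← mul_assoc]
    exact τ.mul_comm' _ _
  have h2 : ‖f.toPreGNS (a * s)‖ ≤ ‖a‖ * ‖f.toPreGNS s‖ := by
    have h3 := (f.leftMulMapPreGNS a).le_opNorm (f.toPreGNS s)
    refine h3.trans ?_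
    gcongr
    exact LinearMap.mkContinuous_norm_le _ (norm_nonneg a) _
  have h4 : ‖f.toPreGNS s‖ * ‖f.toPreGNS s‖ = (τ h).re := by
    rw [PositiveLinearMap.preGNS_norm_def, PositiveLinearMap.ofPreGNS_toPreGNS, hst, hss]
    exact Real.mul_self_sqrt (τ.re_nonneg hh)
  rw [h1]
  calc _ ≤ ‖f.toPreGNS s‖ * ‖f.toPreGNS (a * s)‖ := norm_inner_le_norm _ _
    _ ≤ ‖f.toPreGNS s‖ * (‖a‖ * ‖f.toPreGNS s‖) := by gcongr
    _ = ‖a‖ * (‖f.toPreGNS s‖ * ‖f.toPreGNS s‖) := by ring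
    _ = _ := by rw [h4]

/-- Approximate polar decomposition. -/
theorem exists_approx_polar (x : M) {ε : ℝ} (hε : 0 < ε) :
    ∃ w : M, ‖w‖ ≤ 1 ∧ x = w * (CFC.abs x + (ε : ℂ) • 1) ∧
      CFC.abs x - (ε : ℂ) • 1 ≤ star w * x := by
  set p := CFC.abs x with hp
  have hp0 : 0 ≤ p := CFC.abs_nonneg x
  have hεc : (0 : ℂ) < (ε : ℂ) := by exact_mod_cast hε
  have he0 : (0 : M) ≤ (ε : ℂ) • 1 := smul_nonneg hεc.le zero_le_one
  set h := p + (ε : ℂ) • (1 : M) with hh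
  have hunit : IsUnit h := by
    refine CStarAlgebra.isUnit_of_le ((ε : ℂ) • (1 : M)) (le_add_of_nonneg_left hp0) ?_
    refine IsStrictlyPositive.iff_of_unital.mpr ⟨he0, ?_⟩
    exact ⟨Units.mk0 (ε : ℂ) hεc.ne' • (1 : Mˣ), by simp [Units.smul_def]⟩
  have hh0 : 0 ≤ h := add_nonneg hp0 he0
  obtain ⟨u, hu⟩ := hunit
  have hg0 : (0 : M) ≤ (↑u⁻¹ : M) := CFC.inv_nonneg_of_nonneg u (by rw [hu]; exact hh0)
  set g : M := ↑u⁻¹ with hg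
  have hgh : g * h = 1 := by rw [← hu]; exact u.inv_mul
  have hhg : h * g = 1 := by rw [← hu]; exact u.mul_inv
  have hgs : star g = g := (IsSelfAdjoint.of_nonneg hg0).star_eq
  have hpp : p * p = star x * x := CFC.abs_mul_abs x
  have hsq : h * h - p * p = (2 * ε : ℂ) • p + (ε * ε : ℂ) • 1 := by
    rw [hh]
    simp only [add_mul, mul_add, smul_mul_assoc, mul_smul_comm, one_mul, mul_one]
    module
  refine ⟨x * g, ?_, ?_, ?_⟩
  · have h1 : star (x * g) * (x * g) ≤ 1 := by
      have h2 : p * p ≤ h * h := by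
        rw [← sub_nonneg, hsq]
        refine add_nonneg (smul_nonneg (by positivity) hp0) (smul_nonneg ?_ zero_le_one)
        positivity
      have h3 := star_left_conjugate_le_conjugate h2 g
      have h4 : star g * (h * h) * g = 1 := by
        rw [hgs, ← mul_assoc, hgh, one_mul, hhg]
      rw [h4, hpp] at h3
      simpa [star_mul, mul_assoc] using h3
    have h5 := (CStarAlgebra.norm_le_one_iff_of_nonneg _ (star_mul_self_nonneg (x * g))).mpr h1
    rw [CStarRing.norm_star_mul_self] at h5
    nlinarith [norm_nonneg (x * g)]
  · rw [mul_assoc, hgh, mul_one]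
  · have h1 : star (x * g) * x - (p - (ε : ℂ) • 1) = (ε * ε : ℂ) • g := by
      have h2 : p - (ε : ℂ) • (1 : M) = g * (h * (p - (ε : ℂ) • 1)) := by
        rw [← mul_assoc, hgh, one_mul]
      rw [star_mul, hgs, mul_assoc, ← hpp, h2, ← mul_sub]
      have h3 : p * p - h * (p - (ε : ℂ) • 1) = (ε * ε : ℂ) • 1 := by
        rw [hh]
        simp only [add_mul, mul_sub, smul_mul_assoc, mul_smul_comm, one_mul, mul_one]
        module
      rw [h3, mul_smul_comm, mul_one]
    rw [← sub_nonneg, h1]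
    exact smul_nonneg (by positivity) hg0

theorem re_smul_one (τ : FaithfulNormalFiniteTrace M) (ε : ℝ) :
    (τ ((ε : ℂ) • (1 : M))).re = ε * (τ 1).re := by
  rw [map_smul]; simp

theorem norm_mul_le (τ : FaithfulNormalFiniteTrace M) (y x : M) :
    ‖τ (y * x)‖ ≤ ‖y‖ * τ.traceAbs x := by
  have key : ∀ ε : ℝ, 0 < ε → ‖τ (y * x)‖ ≤ ‖y‖ * (τ.traceAbs x + ε * (τ 1).re) := by
    intro ε hε
    obtain ⟨w, hw, hx, -⟩ := exists_approx_polar x hε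
    have hh0 : 0 ≤ CFC.abs x + (ε : ℂ) • (1 : M) :=
      add_nonneg (CFC.abs_nonneg x) (smul_nonneg (by exact_mod_cast hε.le) zero_le_one)
    have h1 := τ.norm_mul_le_of_nonneg (y * w) hh0
    rw [mul_assoc, ← hx, map_add, Complex.add_re, re_smul_one] at h1
    have h2 : 0 ≤ τ.traceAbs x + ε * (τ 1).re :=
      add_nonneg (τ.re_nonneg (CFC.abs_nonneg x)) (mul_nonneg hε.le (τ.re_nonneg zero_le_one))
    refine h1.trans (mul_le_mul_of_nonneg_right ?_ h2)
    calc ‖y * w‖ ≤ ‖y‖ * ‖w‖ := _root_.norm_mul_le y w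
      _ ≤ ‖y‖ * 1 := by gcongr
      _ = ‖y‖ := mul_one _
  have hlim : Tendsto (fun ε : ℝ => ‖y‖ * (τ.traceAbs x + ε * (τ 1).re)) (𝓝[>] 0)
      (𝓝 (‖y‖ * (τ.traceAbs x + 0 * (τ 1).re))) :=
    (Continuous.tendsto (by fun_prop) 0).mono_left nhdsWithin_le_nhds
  have := ge_of_tendsto hlim (eventually_nhdsWithin_of_forall key)
  simpa using this

theorem norm_apply_le (τ : FaithfulNormalFiniteTrace M) (x : M) : ‖τ x‖ ≤ τ.traceAbs x := by
  rcases subsingleton_or_nontrivial M with hM | hM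
  · have hx : x = 0 := Subsingleton.elim _ _
    rw [hx, map_zero, norm_zero]
    exact τ.re_nonneg (CFC.abs_nonneg (0 : M))
  · simpa using τ.norm_mul_le 1 x

theorem traceAbs_add_le (τ : FaithfulNormalFiniteTrace M) (x y : M) :
    τ.traceAbs (x + y) ≤ τ.traceAbs x + τ.traceAbs y := by
  have hnn : ∀ z : M, 0 ≤ τ.traceAbs z := fun z => τ.re_nonneg (CFC.abs_nonneg z)
  have key : ∀ ε : ℝ, 0 < ε →
      τ.traceAbs (x + y) ≤ τ.traceAbs x + τ.traceAbs y + ε * (τ 1).re := by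
    intro ε hε
    obtain ⟨w, hw, -, hle⟩ := exists_approx_polar (x + y) hε
    have h1 := τ.re_nonneg (sub_nonneg.mpr hle)
    rw [map_sub, map_sub, Complex.sub_re, Complex.sub_re, re_smul_one, mul_add, map_add,
      Complex.add_re] at h1
    have hz : ∀ z : M, (τ (star w * z)).re ≤ τ.traceAbs z := fun z =>
      calc (τ (star w * z)).re ≤ ‖τ (star w * z)‖ := Complex.re_le_norm _
        _ ≤ ‖star w‖ * τ.traceAbs z := τ.norm_mul_le _ _
        _ ≤ 1 * τ.traceAbs z := by
          rw [norm_star]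
          exact mul_le_mul_of_nonneg_right hw (hnn z)
        _ = τ.traceAbs z := one_mul _
    have hx := hz x
    have hy := hz y
    have hxy : τ.traceAbs (x + y) = (τ (CFC.abs (x + y))).re := rfl
    linarith
  have hlim : Tendsto (fun ε : ℝ => τ.traceAbs x + τ.traceAbs y + ε * (τ 1).re) (𝓝[>] 0)
      (𝓝 (τ.traceAbs x + τ.traceAbs y + 0 * (τ 1).re)) :=
    (Continuous.tendsto (by fun_prop) 0).mono_left nhdsWithin_le_nhds
  have := ge_of_tendsto hlim (eventually_nhdsWithin_of_forall key)
  simpa using this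

theorem traceAbs_smul (τ : FaithfulNormalFiniteTrace M) (c : ℂ) (x : M) :
    τ.traceAbs (c • x) = ‖c‖ * τ.traceAbs x := by
  unfold traceAbs
  rw [CFC.abs_smul, PositiveLinearMap.map_smul_of_tower, Complex.smul_re, smul_eq_mul]

theorem eq_zero_of_traceAbs (τ : FaithfulNormalFiniteTrace M) {x : M} (hx : τ.traceAbs x = 0) :
    x = 0 := by
  have h0 := Complex.nonneg_iff.mp (τ.toPositiveLinearMap.map_nonneg (CFC.abs_nonneg x))
  exact CFC.abs_eq_zero_iff.mp
    (τ.faithful _ (CFC.abs_nonneg x) (Complex.ext hx h0.2.symm))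

set_option linter.unusedVariables false in
/-- A copy of `M`, to carry the norm `‖x‖₁ = τ(|x|)`. -/
def PreL1 (τ : FaithfulNormalFiniteTrace M) : Type _ := M

noncomputable instance (τ : FaithfulNormalFiniteTrace M) : AddCommGroup τ.PreL1 :=
  inferInstanceAs (AddCommGroup M)

noncomputable instance (τ : FaithfulNormalFiniteTrace M) : Module ℂ τ.PreL1 := inferInstanceAs (Module ℂ M)

/-- The identity map from `M` to its copy `PreL1 τ`. -/
noncomputable def toPreL1 (τ : FaithfulNormalFiniteTrace M) : M ≃ₗ[ℂ] τ.PreL1 := LinearEquiv.refl ℂ M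

noncomputable instance (τ : FaithfulNormalFiniteTrace M) : Norm τ.PreL1 where
  norm x := τ.traceAbs (τ.toPreL1.symm x)

theorem preL1_core (τ : FaithfulNormalFiniteTrace M) : NormedSpace.Core ℂ τ.PreL1 where
  norm_nonneg _ := τ.re_nonneg (CFC.abs_nonneg _)
  norm_smul c x := τ.traceAbs_smul c x
  norm_triangle x y := τ.traceAbs_add_le x y
  norm_eq_zero_iff x := by
    refine ⟨fun h => τ.eq_zero_of_traceAbs h, ?_⟩
    rintro rfl
    change (τ (CFC.abs (0 : M))).re = 0
    simp

noncomputable instance (τ : FaithfulNormalFiniteTrace M) : NormedAddCommGroup τ.PreL1 :=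
  NormedAddCommGroup.ofCore τ.preL1_core

noncomputable instance (τ : FaithfulNormalFiniteTrace M) : NormedSpace ℂ τ.PreL1 :=
  NormedSpace.ofCore τ.preL1_core

/-- The non-commutative space `L¹(M, τ)`: the completion of `M` in the norm `‖x‖₁ = τ(|x|)`. -/
abbrev L1 (τ : FaithfulNormalFiniteTrace M) : Type _ := Completion τ.PreL1

/-- The canonical dense embedding of `M` into `L¹(M, τ)`. -/
noncomputable def toL1 (τ : FaithfulNormalFiniteTrace M) : M →ₗ[ℂ] τ.L1 :=
  (Completion.toComplₗᵢ (𝕜 := ℂ) (E := τ.PreL1)).toLinearMap ∘ₗ τ.toPreL1.toLinearMap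

/-- The trace as a bounded functional on `(M, ‖·‖₁)`. -/
noncomputable def preL1Trace (τ : FaithfulNormalFiniteTrace M) : τ.PreL1 →L[ℂ] ℂ :=
  LinearMap.mkContinuous (τ.toPositiveLinearMap.toLinearMap ∘ₗ τ.toPreL1.symm.toLinearMap) 1
    fun x => by rw [one_mul]; exact τ.norm_apply_le (τ.toPreL1.symm x)

/-- The trace on `L¹(M, τ)`: the continuous extension of `τ`. -/
noncomputable def l1Trace (τ : FaithfulNormalFiniteTrace M) : τ.L1 →L[ℂ] ℂ :=
  τ.preL1Trace.extend (Completion.toComplL (𝕜 := ℂ) (E := τ.PreL1))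

theorem norm_toL1 (τ : FaithfulNormalFiniteTrace M) (x : M) :
    ‖τ.toL1 x‖ = (τ (CFC.abs x)).re :=
  Completion.norm_coe (τ.toPreL1 x)

theorem denseRange_toL1 (τ : FaithfulNormalFiniteTrace M) : DenseRange τ.toL1 :=
  Completion.denseRange_coe (α := τ.PreL1)

theorem l1Trace_toL1 (τ : FaithfulNormalFiniteTrace M) (x : M) : τ.l1Trace (τ.toL1 x) = τ x :=
  ContinuousLinearMap.extend_eq _ (Completion.denseRange_coe (α := τ.PreL1))
    (Completion.isUniformInducing_coe τ.PreL1) (τ.toPreL1 x)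

/-- The positive elements of `L¹(M, τ)`: the `‖·‖₁`-closure of the set of positive elements
of `M`. -/
def l1Pos (τ : FaithfulNormalFiniteTrace M) : Set τ.L1 := closure (τ.toL1 '' {a : M | 0 ≤ a})

/-- A bounded operator `T` on `L¹(M, τ)` is stochastic if it is positive (`T x ≥ 0` for `x ≥ 0`)
and `τ(T x) = τ(x)` for all `x ≥ 0`. -/
structure IsStochastic (τ : FaithfulNormalFiniteTrace M) (T : τ.L1 →L[ℂ] τ.L1) : Prop where
  map_pos : ∀ x ∈ τ.l1Pos, T x ∈ τ.l1Pos
  trace_map : ∀ x ∈ τ.l1Pos, τ.l1Trace (T x) = τ.l1Trace x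

/-- Pairs of distinct positive elements of `L¹(M, τ)` with equal norms. (Positive elements are
self-adjoint; distinctness only excludes the quotient `0 / 0` below.) -/
def admissiblePairs (τ : FaithfulNormalFiniteTrace M) : Set (τ.L1 × τ.L1) :=
  {p | p.1 ∈ τ.l1Pos ∧ p.2 ∈ τ.l1Pos ∧ ‖p.1‖ = ‖p.2‖ ∧ p.1 ≠ p.2}

/-- The sequence `‖Tⁿ(u - v)‖₁ / ‖u - v‖₁`. -/
noncomputable def mixingRatio (τ : FaithfulNormalFiniteTrace M) (T : τ.L1 →L[ℂ] τ.L1)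
    (p : τ.L1 × τ.L1) (n : ℕ) : ℝ :=
  ‖(T ^ n) (p.1 - p.2)‖ / ‖p.1 - p.2‖

/-- The set of all limits `lim_n ‖Tⁿ(u - v)‖₁ / ‖u - v‖₁`, where `u ≠ v` are positive and
`‖u‖₁ = ‖v‖₁`. -/
def mixingLimits (τ : FaithfulNormalFiniteTrace M) (T : τ.L1 →L[ℂ] τ.L1) : Set ℝ :=
  {r | ∃ p ∈ τ.admissiblePairs, Tendsto (τ.mixingRatio T p) atTop (𝓝 r)}

/-- The coefficient `ρ̄(T)`: the supremum of `lim_n ‖Tⁿ(u - v)‖₁ / ‖u - v‖₁` over all positive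
`u ≠ v` with `‖u‖₁ = ‖v‖₁`. (If there are no such pairs, `dim M ≤ 1` and the value is `0`, the
supremum of the empty set in `[0, ∞)`.) -/
noncomputable def rhoBar (τ : FaithfulNormalFiniteTrace M) (T : τ.L1 →L[ℂ] τ.L1) : ℝ :=
  sSup (τ.mixingLimits T)

/-- `T` is completely mixing if `ρ̄(T) = 0`. -/
def IsCompletelyMixing (τ : FaithfulNormalFiniteTrace M) (T : τ.L1 →L[ℂ] τ.L1) : Prop :=
  τ.rhoBar T = 0

end FaithfulNormalFiniteTrace

namespace FaithfulNormalFiniteTrace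

variable {M : Type*} [CStarAlgebra M] [PartialOrder M] [StarOrderedRing M]

/-! On positive elements the norm is the trace, so `T` is isometric on the cone. Splitting a
self-adjoint element of `M` into positive and negative parts, then using density, shows that `T`
contracts differences of positive elements (`IsStochastic.norm_map_sub_le`). Hence `d n = ‖Tⁿ(u -
v)‖` decreases to some `s ≥ 0`, and every limit of ratios lies in `[0, 1]`.

The dichotomy comes from restarting the orbit. If `s > 0`, then `(Tⁿ u, Tⁿ v)` is again an
admissible pair, and its limit is `s / d n` (`IsStochastic.div_norm_mem_mixingLimits`). As `n → ∞`
these values tend to `1`, so a single nonzero limit already forces the supremum to be `1`. -/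

/-- On the positive cone the `L¹` norm is the trace. -/
theorem norm_eq_re_l1Trace (τ : FaithfulNormalFiniteTrace M) {x : τ.L1} (hx : x ∈ τ.l1Pos) :
    ‖x‖ = (τ.l1Trace x).re := by
  have hclosed : IsClosed {x : τ.L1 | ‖x‖ = (τ.l1Trace x).re} :=
    isClosed_eq continuous_norm (Complex.continuous_re.comp τ.l1Trace.continuous)
  refine closure_minimal ?_ hclosed hx
  rintro _ ⟨a, ha, rfl⟩
  rw [Set.mem_ofPred_eq, norm_toL1, l1Trace_toL1, CFC.abs_of_nonneg a ha]

theorem IsStochastic.norm_map {τ : FaithfulNormalFiniteTrace M} {T : τ.L1 →L[ℂ] τ.L1}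
    (hT : τ.IsStochastic T) {x : τ.L1} (hx : x ∈ τ.l1Pos) : ‖T x‖ = ‖x‖ := by
  rw [norm_eq_re_l1Trace τ (hT.map_pos x hx), hT.trace_map x hx, norm_eq_re_l1Trace τ hx]

theorem toL1_mem_l1Pos (τ : FaithfulNormalFiniteTrace M) {a : M} (ha : 0 ≤ a) :
    τ.toL1 a ∈ τ.l1Pos :=
  subset_closure ⟨a, ha, rfl⟩

/-- The parts `a⁺` and `a⁻` lose no norm under `T`, and their norms add up to that of `a`; only the
triangle inequality for the images can be strict. -/
theorem IsStochastic.norm_map_toL1_le {τ : FaithfulNormalFiniteTrace M} {T : τ.L1 →L[ℂ] τ.L1}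
    (hT : τ.IsStochastic T) {a : M} (ha : IsSelfAdjoint a) : ‖T (τ.toL1 a)‖ ≤ ‖τ.toL1 a‖ := by
  have hp : 0 ≤ a⁺ := CFC.posPart_nonneg a
  have hn : 0 ≤ a⁻ := CFC.negPart_nonneg a
  -- This is the trace of the identity `|a| = a⁺ + a⁻`.
  have hsum : ‖τ.toL1 a⁺‖ + ‖τ.toL1 a⁻‖ = ‖τ.toL1 a‖ := by
    rw [norm_toL1, norm_toL1, norm_toL1, CFC.abs_of_nonneg _ hp, CFC.abs_of_nonneg _ hn,
      ← CFC.posPart_add_negPart a ha, map_add, Complex.add_re]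
  calc ‖T (τ.toL1 a)‖ = ‖T (τ.toL1 a⁺) - T (τ.toL1 a⁻)‖ := by
        rw [← map_sub, ← map_sub, CFC.posPart_sub_negPart a ha]
    _ ≤ ‖T (τ.toL1 a⁺)‖ + ‖T (τ.toL1 a⁻)‖ := norm_sub_le _ _
    _ = ‖τ.toL1 a‖ := by
        rw [hT.norm_map (τ.toL1_mem_l1Pos hp), hT.norm_map (τ.toL1_mem_l1Pos hn), hsum]

/-- A stochastic operator does not increase the norm of a difference of positive elements. -/
theorem IsStochastic.norm_map_sub_le {τ : FaithfulNormalFiniteTrace M} {T : τ.L1 →L[ℂ] τ.L1}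
    (hT : τ.IsStochastic T) {u v : τ.L1} (hu : u ∈ τ.l1Pos) (hv : v ∈ τ.l1Pos) :
    ‖T (u - v)‖ ≤ ‖u - v‖ := by
  have hclosed : IsClosed {p : τ.L1 × τ.L1 | ‖T (p.1 - p.2)‖ ≤ ‖p.1 - p.2‖} :=
    isClosed_le (by fun_prop) (by fun_prop)
  -- Approximating `u` and `v` separately by positive elements of `M` keeps the approximating
  -- difference self-adjoint in `M`, where the bound is known.
  have hmem : (u, v) ∈ closure ((τ.toL1 '' {a : M | 0 ≤ a}) ×ˢ (τ.toL1 '' {a : M | 0 ≤ a})) := by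
    rw [closure_prod_eq]
    exact ⟨hu, hv⟩
  refine closure_minimal ?_ hclosed hmem
  rintro ⟨_, _⟩ ⟨⟨a, ha, rfl⟩, ⟨b, hb, rfl⟩⟩
  change ‖T (τ.toL1 a - τ.toL1 b)‖ ≤ ‖τ.toL1 a - τ.toL1 b‖
  rw [← map_sub τ.toL1]
  exact hT.norm_map_toL1_le ((IsSelfAdjoint.of_nonneg ha).sub (IsSelfAdjoint.of_nonneg hb))

theorem IsStochastic.pow_mem_l1Pos {τ : FaithfulNormalFiniteTrace M} {T : τ.L1 →L[ℂ] τ.L1}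
    (hT : τ.IsStochastic T) (n : ℕ) {x : τ.L1} (hx : x ∈ τ.l1Pos) : (T ^ n) x ∈ τ.l1Pos := by
  induction n with
  | zero => simpa using hx
  | succ n ih =>
    rw [pow_succ', mul_apply_eq_comp]
    exact hT.map_pos _ ih

theorem IsStochastic.norm_pow {τ : FaithfulNormalFiniteTrace M} {T : τ.L1 →L[ℂ] τ.L1}
    (hT : τ.IsStochastic T) (n : ℕ) {x : τ.L1} (hx : x ∈ τ.l1Pos) : ‖(T ^ n) x‖ = ‖x‖ := by
  induction n with
  | zero => simp
  | succ n ih =>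
    rw [pow_succ', mul_apply_eq_comp, hT.norm_map (hT.pow_mem_l1Pos n hx), ih]

theorem IsStochastic.antitone_norm_pow_sub {τ : FaithfulNormalFiniteTrace M}
    {T : τ.L1 →L[ℂ] τ.L1} (hT : τ.IsStochastic T) {u v : τ.L1} (hu : u ∈ τ.l1Pos)
    (hv : v ∈ τ.l1Pos) : Antitone fun n : ℕ => ‖(T ^ n) (u - v)‖ := by
  refine antitone_nat_of_succ_le fun n => ?_
  rw [pow_succ', mul_apply_eq_comp, map_sub (T ^ n)]
  exact hT.norm_map_sub_le (hT.pow_mem_l1Pos n hu) (hT.pow_mem_l1Pos n hv)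

theorem IsStochastic.exists_tendsto_norm_pow_sub {τ : FaithfulNormalFiniteTrace M}
    {T : τ.L1 →L[ℂ] τ.L1} (hT : τ.IsStochastic T) {u v : τ.L1} (hu : u ∈ τ.l1Pos)
    (hv : v ∈ τ.l1Pos) :
    ∃ r : ℝ, Tendsto (fun n : ℕ => ‖(T ^ n) (u - v)‖) atTop (𝓝 r) :=
  ⟨_, tendsto_atTop_ciInf (hT.antitone_norm_pow_sub hu hv)
    ⟨0, by rintro _ ⟨n, rfl⟩; exact norm_nonneg _⟩⟩

theorem nonneg_of_mem_mixingLimits {τ : FaithfulNormalFiniteTrace M} {T : τ.L1 →L[ℂ] τ.L1}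
    {r : ℝ} (hr : r ∈ τ.mixingLimits T) : 0 ≤ r := by
  obtain ⟨p, -, hlim⟩ := hr
  exact ge_of_tendsto' hlim fun n => div_nonneg (norm_nonneg _) (norm_nonneg _)

theorem IsStochastic.le_one_of_mem_mixingLimits {τ : FaithfulNormalFiniteTrace M}
    {T : τ.L1 →L[ℂ] τ.L1} (hT : τ.IsStochastic T) {r : ℝ} (hr : r ∈ τ.mixingLimits T) :
    r ≤ 1 := by
  obtain ⟨p, ⟨hu, hv, -, -⟩, hlim⟩ := hr
  refine le_of_tendsto' hlim fun n => div_le_one_of_le₀ ?_ (norm_nonneg _)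
  simpa using hT.antitone_norm_pow_sub hu hv (Nat.zero_le n)

/-- Following an admissible pair along the orbit of `T` rescales the limit of its mixing ratios. -/
theorem IsStochastic.div_norm_mem_mixingLimits {τ : FaithfulNormalFiniteTrace M}
    {T : τ.L1 →L[ℂ] τ.L1} (hT : τ.IsStochastic T) {u v : τ.L1}
    (huv : (u, v) ∈ τ.admissiblePairs) {s : ℝ}
    (hs : Tendsto (fun n : ℕ => ‖(T ^ n) (u - v)‖) atTop (𝓝 s)) {n : ℕ}
    (hn : (T ^ n) (u - v) ≠ 0) : s / ‖(T ^ n) (u - v)‖ ∈ τ.mixingLimits T := by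
  obtain ⟨hu, hv, hnorm, -⟩ := huv
  refine ⟨((T ^ n) u, (T ^ n) v), ⟨hT.pow_mem_l1Pos n hu, hT.pow_mem_l1Pos n hv, ?_, ?_⟩, ?_⟩
  · rw [hT.norm_pow n hu, hT.norm_pow n hv]
    exact hnorm
  · intro h
    exact hn (by rw [map_sub, sub_eq_zero]; exact h)
  -- The orbit of the new pair is the old orbit shifted by `n`, so the numerators still tend to `s`;
  -- only the denominator changes.
  · have h := ((tendsto_add_atTop_iff_nat n).mpr hs).div_const ‖(T ^ n) (u - v)‖
    refine h.congr fun m => ?_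
    simp only [mixingRatio]
    rw [← map_sub, pow_add, mul_apply_eq_comp]

theorem IsStochastic.rhoBar_eq_one {τ : FaithfulNormalFiniteTrace M} {T : τ.L1 →L[ℂ] τ.L1}
    (hT : τ.IsStochastic T) {r : ℝ} (hr : r ∈ τ.mixingLimits T) (hr0 : r ≠ 0) :
    τ.rhoBar T = 1 := by
  refine le_antisymm (csSup_le ⟨r, hr⟩ fun _ h => hT.le_one_of_mem_mixingLimits h) ?_
  obtain ⟨⟨u, v⟩, huv, hlim⟩ := hr
  obtain ⟨s, hs⟩ := hT.exists_tendsto_norm_pow_sub huv.1 huv.2.1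
  -- The limit `r` equals `s / ‖u - v‖`.
  have hs0 : s ≠ 0 := by
    rintro rfl
    have h := hs.div_const ‖u - v‖
    rw [zero_div] at h
    exact hr0 (tendsto_nhds_unique hlim h)
  have h1 : Tendsto (fun n : ℕ => s / ‖(T ^ n) (u - v)‖) atTop (𝓝 1) := by
    rw [← div_self hs0]
    exact tendsto_const_nhds.div hs hs0
  -- Each `s / ‖Tⁿ(u - v)‖` with nonzero denominator is a competitor in the supremum, and `s ≠ 0`
  -- makes the denominators eventually nonzero.
  refine le_of_tendsto h1 ((hs.eventually_ne hs0).mono fun n hn => ?_)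
  exact le_csSup ⟨1, fun _ h => hT.le_one_of_mem_mixingLimits h⟩
    (hT.div_norm_mem_mixingLimits huv hs (norm_ne_zero_iff.mp hn))

theorem IsStochastic.rhoBar_eq_zero_or_one {τ : FaithfulNormalFiniteTrace M}
    {T : τ.L1 →L[ℂ] τ.L1} (hT : τ.IsStochastic T) : τ.rhoBar T = 0 ∨ τ.rhoBar T = 1 := by
  by_cases h : ∃ r ∈ τ.mixingLimits T, r ≠ 0
  · obtain ⟨r, hr, hr0⟩ := h
    exact Or.inr (hT.rhoBar_eq_one hr hr0)
  · push Not at h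
    -- Neither bound needs a nonempty set: without admissible pairs, `sSup ∅ = 0` in `ℝ`.
    exact Or.inl (le_antisymm (Real.sSup_nonpos fun r hr => (h r hr).le)
      (Real.sSup_nonneg fun r hr => nonneg_of_mem_mixingLimits hr))

end FaithfulNormalFiniteTrace

theorem theorem4p2 {M : Type*} [CStarAlgebra M] [PartialOrder M] [StarOrderedRing M]
    [WStarAlgebra M] (τ : FaithfulNormalFiniteTrace M) (T : τ.L1 →L[ℂ] τ.L1)
    (hT : τ.IsStochastic T) :
    -- the limits in the definition of `ρ̄(T)` exist and their supremum is finite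
    (∀ p ∈ τ.admissiblePairs, ∃ r : ℝ, Tendsto (τ.mixingRatio T p) atTop (𝓝 r)) ∧
    BddAbove (τ.mixingLimits T) ∧
    (τ.rhoBar T = 0 ∨ τ.rhoBar T = 1) ∧
    (τ.rhoBar T < 1 → τ.IsCompletelyMixing T) := by
  refine ⟨fun p hp => ?_, ⟨1, fun _ h => hT.le_one_of_mem_mixingLimits h⟩,
    hT.rhoBar_eq_zero_or_one, fun h => hT.rhoBar_eq_zero_or_one.resolve_right h.ne⟩
  obtain ⟨s, hs⟩ := hT.exists_tendsto_norm_pow_sub hp.1 hp.2.1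
  exact ⟨_, hs.div_const ‖p.1 - p.2‖⟩
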